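/- Let $X=(X(u))_{u\ge 0}$ be a continuous-time Markov chain with right-continuous paths on a finite state space $E$, with generator matrix $P$, started in a stationary distribution $\pi$ for which it is reversible, i.e. $\pi_iP_{il}=\pi_lP_{li}$ for all $i,l$ (as is the case for the CSMA/CA chain, whose states are the sets of simultaneously transmitting links and in which each link that may start transmitting does so at rate $\nu$ and each transmission ends at rate $\mu$). Let $C>0$ and $k\ge 1$, and consider a flow crossing $k$ hops, where hop $j\in\{1,\dots,k\}$ transmits at rate $C$ while $X$ is in a set $F_j\subseteq E$ of favorable states and at rate $0$ otherwise. Thus hop $j$ has the impulse response $$S_j(s,t)=\int_s^t C\,\mathbf 1\{X(u)\in F_j\}\,du\qquad(s\le t\ \text{integers}),$$ and with a saturated source ($A(0)=0$ and $A(s)=\infty$ for $s\ge 1$) the end-to-end departure process is $D=A*S_1*\cdots*S_k$, where $(A*S)(t)=\min_{0\le s\le t}\{A(s)+S(s,t)\}$ over integers $s$; that is, $D(t)=\min_{0=u_0\le u_1\le\dots\le u_k=t}\sum_{j=1}^k S_j(u_{j-1},u_j)$ with integer $u_j$. No independence between the hops is assumed. For real $x$ let $B_j(x)=P-xC I_j$,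 where $I_j$ is the diagonal matrix with entry $1$ at the states of $F_j$ and $0$ elsewhere, and let $\lambda_j(x)$ be the largest real eigenvalue of $B_j(x)$. For $\theta>0$ put $$r_j(-k\theta)=\frac{\lambda_j(k\theta)}{-k\theta},\quad r(-k\theta)=\min_j r_j(-k\theta),\qquad r_j(k\theta)=\frac{\lambda_j(-k\theta)}{k\theta},\quad r(k\theta)=\max_j r_j(k\theta).$$ Let $\varepsilon>0$, let $t\ge 1$ be an integer, and for $\theta>0$ let $$\lambda^L_{t}(\theta)=r(-k\theta)+\frac{\log\varepsilon-\log\binom{t+k-1}{k-1}}{\theta t},\qquad \lambda^U_{t}(\theta)=r(k\theta)-\frac{\log\varepsilon}{\theta t},$$ $$\lambda^L_t=\sup_{\theta>0}\lambda^L_t(\theta),\qquad \lambda^U_t=\inf_{\theta>0}\lambda^U_t(\theta)$$ (the supremum and infimum taken in the extended reals). Then $\lambda_t^L$ and $\lambda_t^U$ are a probabilistic lower and a probabilistic upper bound on the capacity rate with violation probability $\varepsilon$: $$\mathbb P\bigl(D(t)<\lambda^L_t\,t\bigr)\le\varepsilon,\qquad \mathbb P\bigl(D(t)>\lambda^U_t\,t\bigr)\le\varepsilon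 .$$ Moreover, for every $\theta>0$, $$\mathbb P\bigl(D(t)\le\lambda^L_t(\theta)\,t\bigr)\le\varepsilon,\qquad \mathbb P\bigl(D(t)\ge\lambda^U_t(\theta)\,t\bigr)\le\varepsilon ,$$ so that the strict inequalities in the first two events may be replaced by non-strict ones whenever the supremum, respectively the infimum, is attained. -/

import Mathlib

open MeasureTheory Filter Topology
open scoped NNReal

/-- `P` is the generator matrix of a continuous-time Markov chain on the finite state space `E`. -/
structure IsGenerator {E : Type*} [Fintype E] (P : Matrix E E ℝ) : Prop where
  offDiag_nonneg : ∀ i l, i ≠ l → 0 ≤ P i l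
  row_sum : ∀ i, ∑ l, P i l = 0

/-- `p` is a probability vector in detailed balance with `P`; in particular it is a stationary
distribution of the chain with generator `P`. -/
structure IsReversibleDistribution {E : Type*} [Fintype E] (P : Matrix E E ℝ) (p : E → ℝ) :
    Prop where
  nonneg : ∀ i, 0 ≤ p i
  sum_eq_one : ∑ i, p i = 1
  detailed_balance : ∀ i l, p i * P i l = p l * P l i

/-- `X` is a continuous-time Markov chain with generator `P` and initial law `p`: its
finite-dimensional distributions are the ones given by `p` and the transition matrices `exp (t P)`,
and its paths are right-continuous for the discrete topology on the state space. -/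
structure IsMarkovChain {Ω E : Type*} [MeasurableSpace Ω] [Fintype E] [DecidableEq E]
    (μ : Measure Ω) (P : Matrix E E ℝ) (p : E → ℝ) (X : ℝ≥0 → Ω → E) : Prop where
  measurable_fiber : ∀ t i, MeasurableSet {ω | X t ω = i}
  right_continuous : ∀ ω t, ∀ᶠ u in 𝓝[>] t, X u ω = X t ω
  finite_dim : ∀ (n : ℕ) (t : Fin (n + 1) → ℝ≥0) (i : Fin (n + 1) → E), Monotone t →
    μ.real {ω | ∀ m, X (t m) ω = i m} =
      p (i 0) * ∏ m : Fin n,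
        NormedSpace.exp (((t m.succ : ℝ) - (t m.castSucc : ℝ)) • P) (i m.castSucc) (i m.succ)

noncomputable section

/-- The transmission rate in a state of the modulating chain: `C` in the favorable states `F`,
and `0` in the others. -/
def mmtpRate {E : Type*} (C : ℝ) (F : Set E) (i : E) : ℝ :=
  F.indicator (fun _ => C) i

/-- The impulse response `S(s,t)` of a link: the amount of data that the link, if saturated,
transmits between the slot boundaries `s` and `t`. -/
def impulseResponse {Ω E : Type*} (X : ℝ≥0 → Ω → E) (C : ℝ) (F : Set E) (ω : Ω) (s t : ℕ) : ℝ :=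
  ∫ u in (s : ℝ)..(t : ℝ), mmtpRate C F (X u.toNNReal ω)

/-- The `(min,+)` convolution `(A * S)(t) = min_{0 ≤ s ≤ t} (A(s) + S(s,t))`. -/
def minPlusConv (A : ℕ → EReal) (S : ℕ → ℕ → ℝ) (t : ℕ) : EReal :=
  (Finset.range (t + 1)).inf fun s => A s + (S s t : EReal)

/-- The departure process `A * S_1 * ⋯ * S_k` of a flow with arrival process `A` that crosses
`k` hops in series: the departures of each hop are the arrivals at the next one. -/
def departures (A : ℕ → EReal) : (k : ℕ) → (Fin k → ℕ → ℕ → ℝ) → ℕ → EReal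
  | 0, _ => A
  | k + 1, S => minPlusConv (departures A k fun j => S j.castSucc) (S (Fin.last k))

/-- The saturated source: no data up to time `0`, an infinite amount of data afterwards. -/
def saturatedArrivals (t : ℕ) : EReal :=
  if t = 0 then 0 else ⊤

/-- The cumulative end-to-end departures `D(t)` of a saturated flow that crosses `k` hops, the
`j`-th of which transmits at rate `C` while the chain `X` is in the set `F j`. -/
def endToEnd {Ω E : Type*} {k : ℕ} (X : ℝ≥0 → Ω → E) (C : ℝ) (F : Fin k → Set E)
    (t : ℕ) (ω : Ω) : EReal :=
  departures saturatedArrivals k (fun j => impulseResponse X C (F j) ω) t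

/-- The matrix `B = P - x C I`, where `I` is the diagonal 0-1 matrix of the favorable states. -/
def bMatrix {E : Type*} [DecidableEq E] (P : Matrix E E ℝ) (C : ℝ) (F : Set E) (x : ℝ) :
    Matrix E E ℝ :=
  P - (x * C) • Matrix.diagonal (F.indicator fun _ => (1 : ℝ))

/-- The largest (real) eigenvalue of a matrix. -/
def topEigenvalue {E : Type*} [Fintype E] [DecidableEq E] (B : Matrix E E ℝ) : ℝ :=
  sSup (spectrum ℝ B)

/-- The rate `r_j(x) = λ_j / x`, where `λ_j` is the largest eigenvalue of `P - (-x) C I_j`.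
It is used at `x = -kθ` and at `x = kθ`. -/
def hopRate {E : Type*} [Fintype E] [DecidableEq E] (P : Matrix E E ℝ) (C : ℝ) (F : Set E)
    (x : ℝ) : ℝ :=
  topEigenvalue (bMatrix P C F (-x)) / x

/-- `r(-kθ) + (log ε - log (t+k-1 choose k-1)) / (θ t)`, where `r(-kθ) = min_j r_j(-kθ)`. -/
def lowerRateAt {E : Type*} [Fintype E] [DecidableEq E] {k : ℕ} (P : Matrix E E ℝ) (C : ℝ)
    (F : Fin k → Set E) (ε : ℝ) (t : ℕ) (θ : ℝ) : ℝ :=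
  (⨅ j, hopRate P C (F j) (-(k * θ))) +
    (Real.log ε - Real.log ((t + k - 1).choose (k - 1))) / (θ * t)

/-- `r(kθ) - log ε / (θ t)`, where `r(kθ) = max_j r_j(kθ)`. -/
def upperRateAt {E : Type*} [Fintype E] [DecidableEq E] {k : ℕ} (P : Matrix E E ℝ) (C : ℝ)
    (F : Fin k → Set E) (ε : ℝ) (t : ℕ) (θ : ℝ) : ℝ :=
  (⨆ j, hopRate P C (F j) (k * θ)) - Real.log ε / (θ * t)

/-- The lower bound `λ_t^L` on the capacity rate, as a supremum of extended reals. -/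
def lowerRate {E : Type*} [Fintype E] [DecidableEq E] {k : ℕ} (P : Matrix E E ℝ) (C : ℝ)
    (F : Fin k → Set E) (ε : ℝ) (t : ℕ) : EReal :=
  ⨆ θ : Set.Ioi (0 : ℝ), (lowerRateAt P C F ε t θ : EReal)

/-- The upper bound `λ_t^U` on the capacity rate, as an infimum of extended reals. -/
def upperRate {E : Type*} [Fintype E] [DecidableEq E] {k : ℕ} (P : Matrix E E ℝ) (C : ℝ)
    (F : Fin k → Set E) (ε : ℝ) (t : ℕ) : EReal :=
  ⨅ θ : Set.Ioi (0 : ℝ), (upperRateAt P C F ε t θ : EReal)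

end

/-! Everything rests on one moment bound: for a stationary reversible chain, `E exp(y S(s,s+d)) ≤
exp(λ d)`, where `λ` is the largest real eigenvalue of `B = P + y C I`
(`IsMarkovChain.lintegral_exp_impulseResponse_le`). Right-continuity makes the occupation integral a
limit of Riemann sums on the grid `ℕ / n`. The finite-dimensional laws give the exponential moment
of such a sum as `p ⬝ᵥ (exp(P/n) exp(yCI/n))^(nd) *ᵥ 1`, which tends to `p ⬝ᵥ exp(B)^d *ᵥ 1` by the
Lie–Trotter formula, and Fatou's lemma transfers the bound. Adding a diagonal keeps detailed
balance, so conjugation by `diag √p` makes `B` symmetric; the expression becomes a quadratic form at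
the unit vector `√p`, and the spectral theorem bounds it by `exp(λ d)`.

For the lower bound, `D(t)`, when finite, equals the sum of the `S_j` along some path, and the paths
number `(t+k-1).choose (k-1)`. Along a fixed path the hops are dependent, so Hölder's inequality
with exponents `k` splits the moment; this is why the rates are taken at `kθ`. Chernoff's bound and
a union bound finish. For the upper bound, `D(t)` is at most what the last hop alone carries during
`[0,t]`, and Chernoff's bound suffices. Optimising over `θ` uses continuity of the measure along
increasing events. -/

/-! ### The Lie–Trotter product formula. -/

section Trotter

variable {𝔸 : Type*} [NormedRing 𝔸]

/-- Powers of two elements of norm at most `R ≥ 1` differ by at most `n R ^ n` times their distance. -/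
theorem norm_pow_sub_pow_le_mul [NormOneClass 𝔸] {x y : 𝔸} {R : ℝ} (hR : 1 ≤ R)
    (hx : ‖x‖ ≤ R) (hy : ‖y‖ ≤ R)
    (n : ℕ) : ‖x ^ n - y ^ n‖ ≤ n * R ^ n * ‖x - y‖ := by
  induction n with
  | zero => simp
  | succ n ih =>
    have h : x ^ (n + 1) - y ^ (n + 1) = (x ^ n - y ^ n) * x + y ^ n * (x - y) := by
      rw [pow_succ, pow_succ]; noncomm_ring
    have hyn : ‖y ^ n‖ ≤ R ^ (n + 1) :=
      (norm_pow_le y n).trans ((pow_le_pow_left₀ (norm_nonneg _) hy n).trans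
        (pow_le_pow_right₀ hR n.le_succ))
    calc ‖x ^ (n + 1) - y ^ (n + 1)‖
        ≤ ‖x ^ n - y ^ n‖ * ‖x‖ + ‖y ^ n‖ * ‖x - y‖ := by
          rw [h]
          exact (norm_add_le _ _).trans (add_le_add (norm_mul_le _ _) (norm_mul_le _ _))
      _ ≤ (n * R ^ n * ‖x - y‖) * R + R ^ (n + 1) * ‖x - y‖ := by
          gcongr
      _ = (n + 1 : ℕ) * R ^ (n + 1) * ‖x - y‖ := by push_cast; ring

variable [NormedAlgebra ℝ 𝔸]

/-- Both norms are eventually at most `1 + (‖a‖ + 1) / n`, whose `n`-th power stays below `exp (‖a‖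
+ 1)`. Telescoping then leaves a constant times `n ‖x n - y n‖`, which vanishes because the
first-order terms agree. -/
theorem tendsto_pow_sub_pow_of_tendsto_smul [NormOneClass 𝔸] {x y : ℕ → 𝔸} {a : 𝔸}
    (hx : Tendsto (fun n : ℕ => (n : ℝ) • (x n - 1)) atTop (𝓝 a))
    (hy : Tendsto (fun n : ℕ => (n : ℝ) • (y n - 1)) atTop (𝓝 a)) :
    Tendsto (fun n => x n ^ n - y n ^ n) atTop (𝓝 0) := by
  have key : ∀ z : ℕ → 𝔸, Tendsto (fun n : ℕ => (n : ℝ) • (z n - 1)) atTop (𝓝 a) →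
      ∀ᶠ n : ℕ in atTop, ‖z n‖ ≤ 1 + (‖a‖ + 1) / n := by
    intro z hz
    filter_upwards [hz.norm.eventually_le_const (lt_add_one ‖a‖), eventually_gt_atTop 0]
      with n hn hn0
    have hn0' : (0 : ℝ) < n := by exact_mod_cast hn0
    rw [norm_smul, Real.norm_of_nonneg hn0'.le] at hn
    calc ‖z n‖ = ‖1 + (z n - 1)‖ := by congr 1; abel
      _ ≤ 1 + ‖z n - 1‖ := by simpa using norm_add_le (1 : 𝔸) (z n - 1)
      _ ≤ _ := by gcongr; rw [le_div_iff₀ hn0']; linarith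
  have hd : Tendsto (fun n : ℕ => Real.exp (‖a‖ + 1) * ‖(n : ℝ) • (x n - 1) - (n : ℝ) • (y n - 1)‖)
      atTop (𝓝 0) := by
    simpa using (hx.sub hy).norm.const_mul (Real.exp (‖a‖ + 1))
  refine squeeze_zero_norm' ?_ hd
  filter_upwards [key x hx, key y hy, eventually_gt_atTop 0] with n h1 h2 hn0
  have hn0' : (0 : ℝ) < n := by exact_mod_cast hn0
  have hc : 0 ≤ (‖a‖ + 1) / n := by positivity
  have hpow : (1 + (‖a‖ + 1) / n) ^ n ≤ Real.exp (‖a‖ + 1) := by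
    calc (1 + (‖a‖ + 1) / n) ^ n ≤ Real.exp ((‖a‖ + 1) / n) ^ n := by
          gcongr; linarith [Real.add_one_le_exp ((‖a‖ + 1) / n)]
      _ = Real.exp (‖a‖ + 1) := by
          rw [← Real.exp_nat_mul]; congr 1; field_simp
  calc ‖x n ^ n - y n ^ n‖ ≤ n * (1 + (‖a‖ + 1) / n) ^ n * ‖x n - y n‖ :=
        norm_pow_sub_pow_le_mul (by linarith) h1 h2 n
    _ ≤ n * Real.exp (‖a‖ + 1) * ‖x n - y n‖ := by gcongr
    _ = _ := by
        rw [← smul_sub, sub_sub_sub_cancel_right, norm_smul, Real.norm_of_nonneg hn0'.le]; ring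

theorem HasDerivAt.tendsto_natCast_smul_sub_one {f : ℝ → 𝔸} {a : 𝔸} (hf : HasDerivAt f a 0)
    (h0 : f 0 = 1) :
    Tendsto (fun n : ℕ => (n : ℝ) • (f (n : ℝ)⁻¹ - 1)) atTop (𝓝 a) := by
  have h := hf.tendsto_slope_zero_right
  have hinv : Tendsto (fun n : ℕ => (n : ℝ)⁻¹) atTop (𝓝[>] 0) :=
    tendsto_inv_atTop_nhdsGT_zero.comp tendsto_natCast_atTop_atTop
  simpa [Function.comp_def, h0] using h.comp hinv

/-- The Lie–Trotter product formula. -/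
theorem tendsto_exp_mul_exp_pow [NormOneClass 𝔸] [CompleteSpace 𝔸] (a b : 𝔸) :
    Tendsto (fun n : ℕ => (NormedSpace.exp ((n : ℝ)⁻¹ • a) * NormedSpace.exp ((n : ℝ)⁻¹ • b)) ^ n)
      atTop (𝓝 (NormedSpace.exp (a + b))) := by
  let : NormedAlgebra ℚ 𝔸 := NormedAlgebra.restrictScalars ℚ ℝ 𝔸
  have hd : ∀ c : 𝔸, HasDerivAt (fun s : ℝ => NormedSpace.exp (s • c)) c 0 := fun c => by
    simpa using hasDerivAt_exp_smul_const (𝕂 := ℝ) c (0 : ℝ)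
  have h1 := ((hd a).mul (hd b)).tendsto_natCast_smul_sub_one (by simp)
  have h2 := (hd (a + b)).tendsto_natCast_smul_sub_one (by simp)
  have h3 := tendsto_pow_sub_pow_of_tendsto_smul (by simpa using h1) h2
  have h4 : ∀ᶠ n : ℕ in atTop, NormedSpace.exp ((n : ℝ)⁻¹ • (a + b)) ^ n
      = NormedSpace.exp (a + b) := by
    filter_upwards [eventually_gt_atTop 0] with n hn
    have hn0 : (n : ℝ) ≠ 0 := by exact_mod_cast hn.ne'
    rw [← NormedSpace.exp_nsmul, ← Nat.cast_smul_eq_nsmul ℝ, smul_smul, mul_inv_cancel₀ hn0,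
      one_smul]
  have h5 := h3.add_const (NormedSpace.exp (a + b))
  rw [zero_add] at h5
  refine h5.congr' ?_
  filter_upwards [h4] with n hn
  rw [hn, sub_add_cancel]

end Trotter

/-! ### Exponentials and spectra of matrices in detailed balance. -/

section Matrices

variable {E : Type*} [Fintype E] [DecidableEq E]

open Matrix

theorem Matrix.tendsto_exp_mul_exp_pow [Nonempty E] (A B : Matrix E E ℝ) :
    Tendsto (fun n : ℕ => (NormedSpace.exp ((n : ℝ)⁻¹ • A) * NormedSpace.exp ((n : ℝ)⁻¹ • B)) ^ n)
      atTop (𝓝 (NormedSpace.exp (A + B))) := by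
  let : NormedRing (Matrix E E ℝ) := Matrix.linftyOpNormedRing
  let : NormedAlgebra ℝ (Matrix E E ℝ) := Matrix.linftyOpNormedAlgebra
  have : NormOneClass (Matrix E E ℝ) := Matrix.linfty_opNormOneClass
  exact _root_.tendsto_exp_mul_exp_pow A B

theorem Matrix.semiconjBy_exp {A B D : Matrix E E ℝ} (h : SemiconjBy D A B) :
    SemiconjBy D (NormedSpace.exp A) (NormedSpace.exp B) := by
  let : NormedRing (Matrix E E ℝ) := Matrix.linftyOpNormedRing
  let : NormedAlgebra ℝ (Matrix E E ℝ) := Matrix.linftyOpNormedAlgebra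
  let : NormedAlgebra ℚ (Matrix E E ℝ) := NormedAlgebra.restrictScalars ℚ ℝ _
  exact h.exp_right

/-- If all eigenvalues of a real symmetric matrix `S` are at most `c`, then the quadratic form of
`exp S ^ n` is at most `exp (c n)` times the square of the Euclidean norm. -/
theorem Matrix.IsHermitian.dotProduct_exp_pow_mulVec_le {S : Matrix E E ℝ} (hS : S.IsHermitian)
    {c : ℝ} (hc : ∀ i, hS.eigenvalues i ≤ c) (n : ℕ) (w : E → ℝ) :
    w ⬝ᵥ (NormedSpace.exp S ^ n *ᵥ w) ≤ Real.exp (c * n) * (w ⬝ᵥ w) := by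
  set U : Matrix E E ℝ := (hS.eigenvectorUnitary : Matrix E E ℝ) with hU
  have hUU : U * star U = 1 := Unitary.mul_star_self_of_mem hS.eigenvectorUnitary.2
  have hinv : U⁻¹ = star U := Matrix.inv_eq_right_inv hUU
  have hspec : n • S = U * diagonal (fun i => hS.eigenvalues i * n) * U⁻¹ := by
    conv_lhs => rw [hS.spectral_theorem]
    have hd : diagonal (fun i => hS.eigenvalues i * n) = n • diagonal hS.eigenvalues := by
      ext i l
      by_cases h : i = l
      · subst h; simp [mul_comm]
      · simp [h]
    rw [hinv, hd, mul_smul_comm, smul_mul_assoc]; rfl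
  have hexp : NormedSpace.exp S ^ n
      = U * diagonal (fun i => Real.exp (hS.eigenvalues i * n)) * star U := by
    rw [← Matrix.exp_nsmul, hspec, Matrix.exp_conj _ _ (IsUnit.of_mul_eq_one _ hUU),
      Matrix.exp_diagonal, hinv]
    congr 3
    ext i
    rw [Pi.coe_exp, Real.exp_eq_exp_ℝ]
  have hstar : star U = Uᵀ := by
    rw [star_eq_conjTranspose, conjTranspose_eq_transpose_of_trivial]
  set v := star U *ᵥ w with hv
  have hwU : w ᵥ* U = v := by rw [hv, hstar, mulVec_transpose]
  have hvv : v ⬝ᵥ v = w ⬝ᵥ w := by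
    nth_rw 1 [← hwU]
    rw [← dotProduct_mulVec, hv, mulVec_mulVec, hUU, one_mulVec]
  rw [hexp, ← mulVec_mulVec, ← mulVec_mulVec, dotProduct_mulVec, hwU, ← hv, ← hvv]
  simp only [dotProduct, mulVec_diagonal, Finset.mul_sum]
  refine Finset.sum_le_sum fun i _ => ?_
  have h := mul_le_mul_of_nonneg_right
    (Real.exp_le_exp.2 (mul_le_mul_of_nonneg_right (hc i) n.cast_nonneg)) (mul_self_nonneg (v i))
  linarith

/-- A real eigenvalue of `B` is at most `topEigenvalue B`. -/
theorem le_topEigenvalue {B : Matrix E E ℝ} {a : ℝ} (h : a ∈ spectrum ℝ B) :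
    a ≤ topEigenvalue B :=
  le_csSup B.finite_real_spectrum.bddAbove h

theorem Matrix.mem_spectrum_of_mulVec_eq_smul {B : Matrix E E ℝ} {a : ℝ} {v : E → ℝ} (hv : v ≠ 0)
    (h : B *ᵥ v = a • v) : a ∈ spectrum ℝ B := by
  rw [← Matrix.spectrum_toLin']
  refine Module.End.HasEigenvalue.mem_spectrum
    (Module.End.hasEigenvalue_of_hasEigenvector (x := v) ⟨?_, hv⟩)
  rw [Module.End.mem_eigenspace_iff, toLin'_apply, h]

theorem Matrix.spectrum_transpose_real (B : Matrix E E ℝ) : spectrum ℝ Bᵀ = spectrum ℝ B := by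
  ext a
  rw [Matrix.mem_spectrum_iff_isRoot_charpoly, Matrix.mem_spectrum_iff_isRoot_charpoly,
    Matrix.charpoly_transpose]

/-- A matrix in detailed balance with nonnegative weights `p` is intertwined by `diag √p` with a
symmetric matrix none of whose eigenvalues exceeds its largest eigenvalue. -/
theorem exists_isHermitian_semiconjBy {B : Matrix E E ℝ} {p : E → ℝ} (hp : ∀ i, 0 ≤ p i)
    (hB : ∀ i l, p i * B i l = p l * B l i) :
    ∃ (S : Matrix E E ℝ) (hS : S.IsHermitian),
      SemiconjBy (diagonal fun i => √(p i)) B S ∧ ∀ i, hS.eigenvalues i ≤ topEigenvalue B := by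
  classical
  -- On the null states of `p` the conjugation by `√p` breaks down. There `S` is set to
  -- `topEigenvalue B` times the identity, which keeps it symmetric and creates no eigenvalue above
  -- the desired bound.
  set S : Matrix E E ℝ := fun i l =>
    if p l = 0 then (if i = l then topEigenvalue B else 0) else √(p i) * B i l / √(p l) with hSdef
  have hne : ∀ i, p i ≠ 0 → √(p i) ≠ 0 := fun i h => (Real.sqrt_pos.2 ((hp i).lt_of_ne' h)).ne'
  have hzero : ∀ i l, p l = 0 → p i ≠ 0 → B i l = 0 := fun i l hl hi => by
    have := hB i l
    rw [hl, zero_mul] at this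
    exact (mul_eq_zero.1 this).resolve_left hi
  have hsymm : ∀ i l, S l i = S i l := by
    intro i l
    simp only [hSdef]
    by_cases hi : p i = 0 <;> by_cases hl : p l = 0
    · rcases eq_or_ne i l with rfl | h
      · rfl
      · simp [hi, hl, h, h.symm]
    · have h : l ≠ i := fun h => hl (h ▸ hi)
      simp [hi, hl, h]
    · have h : i ≠ l := fun h => hi (h ▸ hl)
      simp [hi, hl, h]
    · simp only [hi, hl, if_false]
      rw [div_eq_div_iff (hne i hi) (hne l hl)]
      have h1 := Real.mul_self_sqrt (hp i)
      have h2 := Real.mul_self_sqrt (hp l)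
      linear_combination B l i * h2 - B i l * h1 - hB i l
  have hS : S.IsHermitian := by
    ext i l
    simpa using hsymm i l
  have hsemi : SemiconjBy (diagonal fun i => √(p i)) B S := by
    ext i l
    rw [diagonal_mul, mul_diagonal]
    simp only [hSdef]
    by_cases hl : p l = 0
    · by_cases hi : p i = 0
      · simp [hi, hl]
      · simp [hl, hzero i l hl hi]
    · simp only [hl, if_false]
      rw [div_mul_cancel₀ _ (hne l hl)]
  refine ⟨S, hS, hsemi, fun j => ?_⟩
  set w : E → ℝ := (hS.eigenvectorBasis j).ofLp with hw
  set a := hS.eigenvalues j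
  have heig : S *ᵥ w = a • w := hS.mulVec_eigenvectorBasis j
  have hw0 : w ≠ 0 := by
    intro h
    have := hS.eigenvectorBasis.orthonormal.ne_zero j
    exact this (by ext i; exact congrFun h i)
  set D : Matrix E E ℝ := diagonal fun i => √(p i) with hD
  -- Either `w` lives on the null states, where `S` acts as the scalar `topEigenvalue B`, or `D *ᵥ
  -- w` is a genuine eigenvector of `Bᵀ`, which has the same spectrum as `B`.
  by_cases hDw : D *ᵥ w = 0
  · obtain ⟨l, hl⟩ := Function.ne_iff.1 hw0
    have hvan : ∀ i, p i ≠ 0 → w i = 0 := fun i hi => by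
      have := congrFun hDw i
      rw [hD, mulVec_diagonal] at this
      exact (mul_eq_zero.1 this).resolve_left (hne i hi)
    have hpl : p l = 0 := by
      by_contra h
      exact hl (hvan l h)
    have h1 : (S *ᵥ w) l = topEigenvalue B * w l := by
      rw [mulVec, dotProduct, Finset.sum_eq_single l]
      · simp [hSdef, hpl]
      · intro i _ hil
        by_cases hi : p i = 0
        · simp [hSdef, hi, hil.symm]
        · rw [hvan i hi, mul_zero]
      · simp
    rw [heig, Pi.smul_apply, smul_eq_mul] at h1
    exact (mul_right_cancel₀ hl h1).le
  · apply le_topEigenvalue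
    rw [← Matrix.spectrum_transpose_real]
    refine Matrix.mem_spectrum_of_mulVec_eq_smul hDw ?_
    have ht : Bᵀ * D = D * S := by
      have := congrArg transpose hsemi.eq
      rw [transpose_mul, transpose_mul, hD, diagonal_transpose] at this
      rw [this]
      congr 1
    rw [mulVec_mulVec, ht, ← mulVec_mulVec, heig, mulVec_smul]

/-- Splitting `p = √p · √p` and moving one factor through `exp B ^ n` turns the left side into the
quadratic form of the symmetrised exponential at `√p`, a unit vector because `p` has mass one. -/
theorem dotProduct_exp_pow_mulVec_one_le {B : Matrix E E ℝ} {p : E → ℝ} (hp : ∀ i, 0 ≤ p i)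
    (hsum : ∑ i, p i = 1) (hB : ∀ i l, p i * B i l = p l * B l i) (n : ℕ) :
    p ⬝ᵥ (NormedSpace.exp B ^ n *ᵥ 1) ≤ Real.exp (topEigenvalue B * n) := by
  obtain ⟨S, hS, hsemi, hle⟩ := exists_isHermitian_semiconjBy hp hB
  set w : E → ℝ := fun i => √(p i) with hw
  have hpw : p = w ᵥ* diagonal w := by
    ext i
    rw [vecMul_diagonal, Real.mul_self_sqrt (hp i)]
  have hw1 : diagonal w *ᵥ 1 = w := by ext i; simp [mulVec_diagonal]
  have hww : w ⬝ᵥ w = 1 := by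
    rw [← hsum]
    exact Finset.sum_congr rfl fun i _ => Real.mul_self_sqrt (hp i)
  have hpow := (Matrix.semiconjBy_exp hsemi).pow_right n
  have h := hS.dotProduct_exp_pow_mulVec_le hle n w
  rw [hww, mul_one] at h
  calc p ⬝ᵥ (NormedSpace.exp B ^ n *ᵥ 1)
      = w ⬝ᵥ ((diagonal w * NormedSpace.exp B ^ n) *ᵥ 1) := by
        conv_lhs => rw [hpw]
        rw [← dotProduct_mulVec, mulVec_mulVec]
    _ = w ⬝ᵥ (NormedSpace.exp S ^ n *ᵥ w) := by rw [hpow.eq, ← mulVec_mulVec, hw1]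
    _ ≤ _ := h

end Matrices

/-! ### Convergence of right-endpoint Riemann sums. -/

section RiemannSums

/-- The right end point of the cell of the grid `ℕ / n` that contains `u`. -/
noncomputable def gridCeil (n : ℕ) (u : ℝ) : ℝ≥0 := (⌈u * n⌉₊ : ℝ≥0) / n

theorem tendsto_gridCeil {u : ℝ} (hu : 0 ≤ u) :
    Tendsto (fun n => gridCeil n u) atTop (𝓝[≥] u.toNNReal) := by
  rw [tendsto_nhdsWithin_iff]
  constructor
  · rw [← NNReal.tendsto_coe, Real.coe_toNNReal u hu]
    simpa [gridCeil, Function.comp_def] using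
      (tendsto_nat_ceil_mul_div_atTop hu).comp tendsto_natCast_atTop_atTop
  · filter_upwards [eventually_gt_atTop 0] with n hn
    have hn0 : (0 : ℝ) < n := by exact_mod_cast hn
    rw [Set.mem_Ici, ← NNReal.coe_le_coe, Real.coe_toNNReal u hu]
    simp only [gridCeil, NNReal.coe_div, NNReal.coe_natCast]
    rw [le_div_iff₀ hn0]
    exact Nat.le_ceil _

theorem gridCeil_eq {n : ℕ} (hn : 0 < n) {m : ℕ} {u : ℝ} (h₁ : (m : ℝ) / n < u)
    (h₂ : u ≤ ((m + 1 : ℕ) : ℝ) / n) : gridCeil n u = ((m + 1 : ℕ) : ℝ≥0) / n := by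
  have hn0 : (0 : ℝ) < n := by exact_mod_cast hn
  rw [div_lt_iff₀ hn0] at h₁
  rw [le_div_iff₀ hn0] at h₂
  have : ⌈u * n⌉₊ = m + 1 := by
    rw [Nat.ceil_eq_iff (by simp)]
    exact ⟨by simpa using h₁, h₂⟩
  rw [gridCeil, this]

theorem measurable_gridCeil_comp (f : ℝ≥0 → ℝ) (n : ℕ) : Measurable fun u => f (gridCeil n u) :=
  (measurable_from_nat (f := fun m : ℕ => f ((m : ℝ≥0) / n))).comp
    (Nat.measurable_ceil.comp (measurable_id.mul_const _))

theorem integral_gridCeil {f : ℝ≥0 → ℝ} {K : ℝ} (hK : ∀ u, |f u| ≤ K) {n : ℕ} (hn : 0 < n)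
    (s d : ℕ) :
    ∫ u in (s : ℝ)..((s + d : ℕ) : ℝ), f (gridCeil n u) =
      (n : ℝ)⁻¹ * ∑ m ∈ Finset.range (n * d), f (((n * s + m + 1 : ℕ) : ℝ≥0) / n) := by
  have hn0 : (n : ℝ) ≠ 0 := by exact_mod_cast hn.ne'
  have hint : ∀ a b : ℝ, IntervalIntegrable (fun u => f (gridCeil n u)) volume a b := fun a b =>
    (intervalIntegrable_const (c := K)).mono_fun
      (measurable_gridCeil_comp f n).aestronglyMeasurable
      (ae_of_all _ fun u => (hK _).trans (le_abs_self K))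
  have h := intervalIntegral.sum_integral_adjacent_intervals (μ := volume)
    (f := fun u => f (gridCeil n u))
    (a := fun m : ℕ => ((n * s + m : ℕ) : ℝ) / n) (n := n * d) fun m _ => hint _ _
  have e0 : ((n * s + 0 : ℕ) : ℝ) / n = s := by push_cast; field_simp; ring
  have e1 : ((n * s + n * d : ℕ) : ℝ) / n = ((s + d : ℕ) : ℝ) := by push_cast; field_simp
  rw [e0, e1] at h
  rw [← h, Finset.mul_sum]
  refine Finset.sum_congr rfl fun m _ => ?_
  have hlen : ((n * s + (m + 1) : ℕ) : ℝ) / n - ((n * s + m : ℕ) : ℝ) / n = (n : ℝ)⁻¹ := by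
    push_cast; field_simp; ring
  have hle : ((n * s + m : ℕ) : ℝ) / n ≤ ((n * s + (m + 1) : ℕ) : ℝ) / n := by
    have : (0 : ℝ) ≤ (n : ℝ)⁻¹ := by positivity
    linarith
  rw [intervalIntegral.integral_congr_Ioo_of_le (g := fun _ => f (((n * s + m + 1 : ℕ) : ℝ≥0) / n))
    hle fun u hu => ?_, intervalIntegral.integral_const, hlen, smul_eq_mul]
  simp only
  rw [gridCeil_eq hn hu.1 hu.2.le]

/-- The Riemann sums over right end points of a bounded right-continuous step function converge
to its integral. -/
theorem tendsto_riemannSum_of_right_eventually_const {f : ℝ≥0 → ℝ} {K : ℝ} (hK : ∀ u, |f u| ≤ K)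
    (hf : ∀ u, ∀ᶠ v in 𝓝[>] u, f v = f u) (s d : ℕ) :
    Tendsto (fun n : ℕ =>
        (n : ℝ)⁻¹ * ∑ m ∈ Finset.range (n * d), f (((n * s + m + 1 : ℕ) : ℝ≥0) / n)) atTop
      (𝓝 (∫ u in (s : ℝ)..((s + d : ℕ) : ℝ), f u.toNNReal)) := by
  have hlim : Tendsto (fun n : ℕ => ∫ u in (s : ℝ)..((s + d : ℕ) : ℝ), f (gridCeil n u)) atTop
      (𝓝 (∫ u in (s : ℝ)..((s + d : ℕ) : ℝ), f u.toNNReal)) := by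
    refine intervalIntegral.tendsto_integral_filter_of_dominated_convergence (fun _ => K)
      (Eventually.of_forall fun n => (measurable_gridCeil_comp f n).aestronglyMeasurable)
      (Eventually.of_forall fun n => ae_of_all _ fun u _ => hK _) intervalIntegrable_const
      (ae_of_all _ fun u hu => ?_)
    have hu0 : 0 ≤ u := by
      rw [Set.uIoc_of_le (by simp)] at hu
      exact (Nat.cast_nonneg s).trans hu.1.le
    -- The grid point may coincide with `u`, so the punctured right neighbourhood is enlarged by `u`
    -- itself.
    have hev : ∀ᶠ v in 𝓝[≥] u.toNNReal, f v = f u.toNNReal := by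
      rw [← Set.Ioi_insert, nhdsWithin_insert, eventually_sup]
      exact ⟨by simp, hf _⟩
    exact tendsto_const_nhds.congr' (((tendsto_gridCeil hu0).eventually hev).mono fun n h => h.symm)
  refine hlim.congr' ?_
  filter_upwards [eventually_gt_atTop 0] with n hn
  exact integral_gridCeil hK hn s d

end RiemannSums

/-! ### Exponential moments of the impulse response. -/

section MarkovChain

open Matrix

/-- Summing out the first state replaces `f` by `f ᵥ* M`, so the induction must let `f` vary. -/
theorem sum_prod_transitions {E : Type*} [Fintype E] [DecidableEq E] (M : Matrix E E ℝ)
    (f : E → ℝ) (N : ℕ) :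
    ∑ i : Fin (N + 1) → E, f (i 0) * ∏ m : Fin N, M (i m.castSucc) (i m.succ) =
      f ⬝ᵥ (M ^ N *ᵥ 1) := by
  induction N generalizing f with
  | zero =>
    rw [← (Equiv.funUnique (Fin 1) E).symm.sum_comp]
    simp [dotProduct]
  | succ N ih =>
    rw [pow_succ', ← mulVec_mulVec, dotProduct_mulVec, ← ih,
      ← (Fin.consEquiv fun _ => E).sum_comp, Fintype.sum_prod_type, Finset.sum_comm]
    refine Finset.sum_congr rfl fun i _ => ?_
    rw [vecMul, dotProduct, Finset.sum_mul]
    refine Finset.sum_congr rfl fun a _ => ?_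
    rw [Fin.prod_univ_succ]
    simp [Fin.consEquiv, mul_assoc]

variable {Ω E : Type*} [MeasurableSpace Ω] [Fintype E] [DecidableEq E] {μ : Measure Ω}
  {P : Matrix E E ℝ} {p : E → ℝ} {X : ℝ≥0 → Ω → E}

theorem IsMarkovChain.measurable_comp (hX : IsMarkovChain μ P p X) (g : E → ℝ) (t : ℝ≥0) :
    Measurable fun ω => g (X t ω) := by
  let _ : MeasurableSpace E := ⊤
  have : Measurable (X t) := measurable_to_countable' fun i => hX.measurable_fiber t i
  exact (measurable_from_top (f := g)).comp this

/-- Each weight `g` is evaluated at the end of a step and is absorbed as a column factor of the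
transition matrix. The offset `a` drops out because the law at every starting time is `p`. -/
theorem IsMarkovChain.lintegral_prod [IsProbabilityMeasure μ] (hX : IsMarkovChain μ P p X)
    {g : E → ℝ} (hg : ∀ i, 0 ≤ g i) (n a N : ℕ) (hn : 0 < n) :
    ∫⁻ ω, ENNReal.ofReal (∏ m ∈ Finset.range N, g (X (((a + m + 1 : ℕ) : ℝ≥0) / n) ω)) ∂μ =
      ENNReal.ofReal
        (p ⬝ᵥ ((NormedSpace.exp ((n : ℝ)⁻¹ • P) * diagonal g) ^ N *ᵥ 1)) := by
  let _ : MeasurableSpace E := ⊤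
  have hmeas : ∀ t, Measurable (X t) := fun t =>
    measurable_to_countable' fun i => hX.measurable_fiber t i
  let τ : Fin (N + 1) → ℝ≥0 := fun m => ((a + m : ℕ) : ℝ≥0) / n
  let Y : Ω → Fin (N + 1) → E := fun ω m => X (τ m) ω
  have hY : Measurable Y := measurable_pi_iff.2 fun m => hmeas _
  let φ : (Fin (N + 1) → E) → ℝ := fun i => ∏ m : Fin N, g (i m.succ)
  have hφ : ∀ i, 0 ≤ φ i := fun i => Finset.prod_nonneg fun m _ => hg _
  have hτ : Monotone τ := fun x y h => by
    dsimp only [τ]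
    gcongr
    exact h
  have h1 : ∀ ω, ∏ m ∈ Finset.range N, g (X (((a + m + 1 : ℕ) : ℝ≥0) / n) ω) = φ (Y ω) := by
    intro ω
    rw [← Fin.prod_univ_eq_prod_range (fun m => g (X (((a + m + 1 : ℕ) : ℝ≥0) / n) ω)) N]
    simp [φ, Y, τ, add_assoc]
  have hlaw : ∀ i, (μ.map Y).real {i} = p (i 0) * ∏ m : Fin N,
      NormedSpace.exp ((n : ℝ)⁻¹ • P) (i m.castSucc) (i m.succ) := by
    intro i
    have hset : Y ⁻¹' {i} = {ω | ∀ m, X (τ m) ω = i m} := by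
      ext ω; exact funext_iff
    rw [map_measureReal_apply hY (measurableSet_singleton i), hset, hX.finite_dim N τ i hτ]
    congr 1
    refine Finset.prod_congr rfl fun m _ => ?_
    have : ((τ m.succ : ℝ) - (τ m.castSucc : ℝ)) = (n : ℝ)⁻¹ := by
      have hn0 : (n : ℝ) ≠ 0 := by exact_mod_cast hn.ne'
      simp only [τ, Fin.val_succ, Fin.val_castSucc, NNReal.coe_div, NNReal.coe_natCast]
      push_cast; field_simp; ring
    rw [this]
  have hterm : ∀ i : Fin (N + 1) → E, p (i 0) * ∏ m : Fin N,
      (NormedSpace.exp ((n : ℝ)⁻¹ • P) * diagonal g) (i m.castSucc) (i m.succ) =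
      φ i * (μ.map Y).real {i} := fun i => by
    simp only [hlaw, mul_diagonal, Finset.prod_mul_distrib, φ]
    ring
  have : IsProbabilityMeasure (μ.map Y) := Measure.isProbabilityMeasure_map hY.aemeasurable
  simp_rw [h1]
  rw [← lintegral_map (f := fun i => ENNReal.ofReal (φ i)) (measurable_of_countable _) hY,
    lintegral_fintype, ← sum_prod_transitions, ENNReal.ofReal_sum_of_nonneg]
  · refine Finset.sum_congr rfl fun i _ => ?_
    rw [hterm, ENNReal.ofReal_mul (hφ i), ofReal_measureReal]
  · intro i _
    rw [hterm]
    exact mul_nonneg (hφ i) measureReal_nonneg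

theorem abs_mmtpRate_le {E : Type*} (C : ℝ) (F : Set E) (i : E) : |mmtpRate C F i| ≤ |C| := by
  classical
  rw [mmtpRate, Set.indicator_apply]
  split_ifs <;> simp

theorem bMatrix_neg {E : Type*} [DecidableEq E] (P : Matrix E E ℝ) (C : ℝ) (F : Set E) (y : ℝ) :
    bMatrix P C F (-y) = P + diagonal fun i => y * mmtpRate C F i := by
  classical
  ext i l
  by_cases h : i = l
  · subst h
    by_cases hF : i ∈ F <;> simp [bMatrix, mmtpRate, hF]
  · simp [bMatrix, h]

theorem IsMarkovChain.tendsto_impulseResponse (hX : IsMarkovChain μ P p X) (C : ℝ) (F : Set E)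
    (s d : ℕ) (ω : Ω) :
    Tendsto (fun n : ℕ => (n : ℝ)⁻¹ * ∑ m ∈ Finset.range (n * d),
        mmtpRate C F (X (((n * s + m + 1 : ℕ) : ℝ≥0) / n) ω)) atTop
      (𝓝 (impulseResponse X C F ω s (s + d))) :=
  tendsto_riemannSum_of_right_eventually_const (f := fun u => mmtpRate C F (X u ω))
    (fun u => abs_mmtpRate_le C F _)
    (fun u => (hX.right_continuous ω u).mono fun v hv => by rw [hv]) s d

theorem IsMarkovChain.measurable_impulseResponse (hX : IsMarkovChain μ P p X) (C : ℝ) (F : Set E)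
    (s d : ℕ) : Measurable fun ω => impulseResponse X C F ω s (s + d) :=
  measurable_of_tendsto_metrizable
    (fun n => (Finset.measurable_sum _ fun _ _ =>
      hX.measurable_comp (mmtpRate C F) _).const_mul (n : ℝ)⁻¹)
    (tendsto_pi_nhds.2 fun ω => hX.tendsto_impulseResponse C F s d ω)

theorem IsReversibleDistribution.bMatrix_detailed_balance (hp : IsReversibleDistribution P p)
    (C : ℝ) (F : Set E) (x : ℝ) (i l : E) :
    p i * bMatrix P C F x i l = p l * bMatrix P C F x l i := by
  rcases eq_or_ne i l with rfl | h
  · rfl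
  · simpa [bMatrix, h, h.symm] using hp.detailed_balance i l

/-- Fatou's lemma suffices for the Riemann sums, since only an upper bound on the moment is needed.
The sign of `y` is free: negative values serve the lower capacity bound, positive ones the upper. -/
theorem IsMarkovChain.lintegral_exp_impulseResponse_le [IsProbabilityMeasure μ]
    (hX : IsMarkovChain μ P p X) (hp : IsReversibleDistribution P p) (C : ℝ) (F : Set E) (y : ℝ)
    (s d : ℕ) :
    ∫⁻ ω, ENNReal.ofReal (Real.exp (y * impulseResponse X C F ω s (s + d))) ∂μ ≤
      ENNReal.ofReal (Real.exp (topEigenvalue (bMatrix P C F (-y)) * d)) := by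
  obtain ⟨ω₀⟩ : Nonempty Ω := μ.nonempty_of_neZero
  have : Nonempty E := ⟨X 0 ω₀⟩
  set V : E → ℝ := fun i => y * mmtpRate C F i with hV
  set Z : ℕ → Ω → ℝ := fun n ω => (n : ℝ)⁻¹ * ∑ m ∈ Finset.range (n * d),
    mmtpRate C F (X (((n * s + m + 1 : ℕ) : ℝ≥0) / n) ω) with hZ
  have hZm : ∀ n, Measurable (Z n) := fun n => (Finset.measurable_sum _ fun m _ =>
    hX.measurable_comp (mmtpRate C F) _).const_mul (n : ℝ)⁻¹
  have hZlim : ∀ ω, Tendsto (fun n => ENNReal.ofReal (Real.exp (y * Z n ω))) atTop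
      (𝓝 (ENNReal.ofReal (Real.exp (y * impulseResponse X C F ω s (s + d))))) := fun ω =>
    ENNReal.tendsto_ofReal ((Real.continuous_exp.tendsto _).comp
      ((hX.tendsto_impulseResponse C F s d ω).const_mul y))
  set a : ℕ → ℝ := fun n => p ⬝ᵥ ((NormedSpace.exp ((n : ℝ)⁻¹ • P) *
    NormedSpace.exp ((n : ℝ)⁻¹ • diagonal V)) ^ (n * d) *ᵥ 1) with ha
  have hint : ∀ᶠ n : ℕ in atTop,
      ∫⁻ ω, ENNReal.ofReal (Real.exp (y * Z n ω)) ∂μ = ENNReal.ofReal (a n) := by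
    filter_upwards [eventually_gt_atTop 0] with n hn
    have hdiag : NormedSpace.exp ((n : ℝ)⁻¹ • diagonal V) =
        diagonal fun i => Real.exp ((n : ℝ)⁻¹ * V i) := by
      rw [← diagonal_smul, Matrix.exp_diagonal]
      congr 1
      ext i
      rw [Pi.coe_exp, Real.exp_eq_exp_ℝ]
      rfl
    simp only [ha, hdiag]
    rw [← hX.lintegral_prod (fun i => (Real.exp_pos _).le) n (n * s) (n * d) hn]
    refine lintegral_congr fun ω => ?_
    rw [← Real.exp_sum]
    simp only [hZ, hV, Finset.mul_sum]
    congr 2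
    exact Finset.sum_congr rfl fun m _ => by ring
  have hlim : Tendsto a atTop (𝓝 (p ⬝ᵥ (NormedSpace.exp (bMatrix P C F (-y)) ^ d *ᵥ 1))) := by
    have hT := (Matrix.tendsto_exp_mul_exp_pow P (diagonal V)).pow d
    rw [← bMatrix_neg] at hT
    have hcont : Continuous fun M : Matrix E E ℝ => p ⬝ᵥ (M *ᵥ 1) := by fun_prop
    simpa only [ha, pow_mul, Function.comp_def] using (hcont.tendsto _).comp hT
  calc ∫⁻ ω, ENNReal.ofReal (Real.exp (y * impulseResponse X C F ω s (s + d))) ∂μ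
      = ∫⁻ ω, liminf (fun n => ENNReal.ofReal (Real.exp (y * Z n ω))) atTop ∂μ :=
        lintegral_congr fun ω => (hZlim ω).liminf_eq.symm
    _ ≤ liminf (fun n => ∫⁻ ω, ENNReal.ofReal (Real.exp (y * Z n ω)) ∂μ) atTop :=
        lintegral_liminf_le fun n =>
          ENNReal.measurable_ofReal.comp (Real.measurable_exp.comp ((hZm n).const_mul y))
    _ = ENNReal.ofReal (p ⬝ᵥ (NormedSpace.exp (bMatrix P C F (-y)) ^ d *ᵥ 1)) :=
        ((ENNReal.tendsto_ofReal hlim).congr' (hint.mono fun n h => h.symm)).liminf_eq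
    _ ≤ _ := ENNReal.ofReal_le_ofReal (dotProduct_exp_pow_mulVec_one_le hp.nonneg hp.sum_eq_one
        (hp.bMatrix_detailed_balance C F (-y)) d)

end MarkovChain

/-! ### Path representation of the departures of a saturated flow. -/

section MinPlus

/-- The time at which a path that spends `d i` slots at hop `i` arrives at hop `j`. -/
def pathStart {k : ℕ} (d : Fin k → ℕ) (j : Fin k) : ℕ := ∑ i, if i < j then d i else 0

theorem pathStart_snoc_castSucc {k : ℕ} (d : Fin k → ℕ) (a : ℕ) (j : Fin k) :
    pathStart (Fin.snoc d a : Fin (k + 1) → ℕ) j.castSucc = pathStart d j := by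
  simp [pathStart, Fin.sum_univ_castSucc, Fin.castSucc_lt_castSucc_iff, (Fin.le_last _).not_gt]

theorem pathStart_snoc_last {k : ℕ} (d : Fin k → ℕ) (a : ℕ) :
    pathStart (Fin.snoc d a : Fin (k + 1) → ℕ) (Fin.last k) = ∑ i, d i := by
  simp [pathStart, Fin.sum_univ_castSucc, Fin.castSucc_lt_last]

/-- The departures of a saturated flow, when finite, are attained along some path. -/
theorem departures_saturated_eq (k : ℕ) (S : Fin k → ℕ → ℕ → ℝ) (t : ℕ) :
    departures saturatedArrivals k S t = ⊤ ∨ ∃ d : Fin k → ℕ, ∑ i, d i = t ∧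
      departures saturatedArrivals k S t =
        ((∑ j, S j (pathStart d j) (pathStart d j + d j) : ℝ) : EReal) := by
  induction k generalizing t with
  | zero =>
    by_cases h : t = 0
    · exact .inr ⟨0, by simp [h], by simp [departures, saturatedArrivals, h]⟩
    · exact .inl (by simp [departures, saturatedArrivals, h])
  | succ k ih =>
    obtain ⟨s, hs, hmin⟩ := Finset.exists_mem_eq_inf (Finset.range (t + 1)) (by simp)
      fun s => departures saturatedArrivals k (fun j => S j.castSucc) s +
        (S (Fin.last k) s t : EReal)
    have hst : s ≤ t := Nat.lt_succ_iff.1 (Finset.mem_range.1 hs)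
    rcases ih (fun j => S j.castSucc) s with htop | ⟨d, hd, hval⟩
    · left
      rw [departures, minPlusConv, hmin, htop, EReal.top_add_coe]
    · refine .inr ⟨Fin.snoc d (t - s), ?_, ?_⟩
      · simp [Fin.sum_univ_castSucc, hd, hst]
      · rw [departures, minPlusConv, hmin, hval, ← EReal.coe_add, Fin.sum_univ_castSucc]
        simp [pathStart_snoc_castSucc, pathStart_snoc_last, hd, hst]

theorem departures_saturated_zero_le (k : ℕ) (S : Fin k → ℕ → ℕ → ℝ) (hS : ∀ j, S j 0 0 = 0) :
    departures saturatedArrivals k S 0 ≤ 0 := by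
  induction k with
  | zero => simp [departures, saturatedArrivals]
  | succ k ih =>
    rw [departures, minPlusConv]
    refine (Finset.inf_le (Finset.mem_range.2 zero_lt_one)).trans ?_
    simpa [hS] using ih (fun j => S j.castSucc) fun j => hS _

/-- The path that crosses all earlier hops in zero time and spends all `t` slots at the last hop is
admissible. -/
theorem departures_saturated_succ_le (k : ℕ) (S : Fin (k + 1) → ℕ → ℕ → ℝ)
    (hS : ∀ j, S j 0 0 = 0) (t : ℕ) :
    departures saturatedArrivals (k + 1) S t ≤ (S (Fin.last k) 0 t : EReal) := by
  rw [departures, minPlusConv]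
  refine (Finset.inf_le (Finset.mem_range.2 t.succ_pos)).trans ?_
  calc _ ≤ (0 : EReal) + (S (Fin.last k) 0 t : EReal) :=
        add_le_add_left (departures_saturated_zero_le k _ fun j => hS _) _
    _ = _ := zero_add _

end MinPlus

/-! ### Chernoff's bound and Hölder's inequality for dependent hops. -/

section Chernoff

variable {Ω : Type*} [MeasurableSpace Ω] {μ : Measure Ω}

/-- Markov's inequality for `exp (y Z)`. Keeping `y` on both sides of the event covers both tails,
according to the sign of `y`. -/
theorem measure_le_ofReal_exp_of_lintegral_exp_le {Z : Ω → ℝ} (hZ : Measurable Z) {y b : ℝ}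
    (h : ∫⁻ ω, ENNReal.ofReal (Real.exp (y * Z ω)) ∂μ ≤ ENNReal.ofReal (Real.exp b)) (x : ℝ) :
    μ {ω | y * x ≤ y * Z ω} ≤ ENNReal.ofReal (Real.exp (b - y * x)) := by
  have hm : Measurable fun ω => ENNReal.ofReal (Real.exp (y * Z ω)) :=
    ENNReal.measurable_ofReal.comp (Real.measurable_exp.comp (hZ.const_mul y))
  have hset : {ω | y * x ≤ y * Z ω} ⊆
      {ω | ENNReal.ofReal (Real.exp (y * x)) ≤ ENNReal.ofReal (Real.exp (y * Z ω))} := fun ω hω =>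
    ENNReal.ofReal_le_ofReal (Real.exp_le_exp.2 hω)
  have h0 : ENNReal.ofReal (Real.exp (y * x)) ≠ 0 := by simp [Real.exp_pos]
  calc μ {ω | y * x ≤ y * Z ω}
      ≤ (∫⁻ ω, ENNReal.ofReal (Real.exp (y * Z ω)) ∂μ) / ENNReal.ofReal (Real.exp (y * x)) :=
        (measure_mono hset).trans
          (meas_ge_le_lintegral_div hm.aemeasurable h0 ENNReal.ofReal_ne_top)
    _ ≤ ENNReal.ofReal (Real.exp b) / ENNReal.ofReal (Real.exp (y * x)) := by gcongr
    _ = _ := by rw [← ENNReal.ofReal_div_of_pos (Real.exp_pos _), Real.exp_sub]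

/-- Hölder's inequality for the moment generating function of a sum of `k` random variables. -/
theorem lintegral_exp_sum_le {k : ℕ} (hk : 1 ≤ k) {Z : Fin k → Ω → ℝ} (hZ : ∀ j, Measurable (Z j))
    {y : ℝ} {b : Fin k → ℝ}
    (h : ∀ j, ∫⁻ ω, ENNReal.ofReal (Real.exp (k * y * Z j ω)) ∂μ ≤ ENNReal.ofReal (Real.exp (b j))) :
    ∫⁻ ω, ENNReal.ofReal (Real.exp (y * ∑ j, Z j ω)) ∂μ ≤
      ENNReal.ofReal (Real.exp ((∑ j, b j) / k)) := by
  have hk0 : (k : ℝ) ≠ 0 := by exact_mod_cast (Nat.one_le_iff_ne_zero.1 hk)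
  have hprod : ∀ c : Fin k → ℝ, ∏ j, ENNReal.ofReal (Real.exp (c j)) ^ (k : ℝ)⁻¹ =
      ENNReal.ofReal (Real.exp ((∑ j, c j) / k)) := by
    intro c
    rw [Finset.sum_div, Real.exp_sum, ENNReal.ofReal_prod_of_nonneg fun j _ => (Real.exp_pos _).le]
    refine Finset.prod_congr rfl fun j _ => ?_
    rw [ENNReal.ofReal_rpow_of_pos (Real.exp_pos _), ← Real.exp_mul, div_eq_mul_inv]
  calc ∫⁻ ω, ENNReal.ofReal (Real.exp (y * ∑ j, Z j ω)) ∂μ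
      = ∫⁻ ω, ∏ j, ENNReal.ofReal (Real.exp (k * y * Z j ω)) ^ (k : ℝ)⁻¹ ∂μ := by
        refine lintegral_congr fun ω => ?_
        rw [hprod, ← Finset.mul_sum]
        congr 2
        field_simp
    _ ≤ ∏ j, (∫⁻ ω, ENNReal.ofReal (Real.exp (k * y * Z j ω)) ∂μ) ^ (k : ℝ)⁻¹ :=
        ENNReal.lintegral_prod_norm_pow_le _
          (fun j _ => (ENNReal.measurable_ofReal.comp
            (Real.measurable_exp.comp ((hZ j).const_mul _))).aemeasurable)
          (by simp [hk0]) fun j _ => by positivity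
    _ ≤ ∏ j, ENNReal.ofReal (Real.exp (b j)) ^ (k : ℝ)⁻¹ :=
        Finset.prod_le_prod' fun j _ => ENNReal.rpow_le_rpow (h j) (by positivity)
    _ = _ := hprod b

end Chernoff

/-! ### Passage to the optimal `θ`. -/

section Limits

variable {Ω : Type*} [MeasurableSpace Ω] {μ : Measure Ω}

/-- Choose values of `u` increasing to the supremum. A point strictly below the supremum lies below
one of them, so the event is covered by an increasing union of events of measure at most `c`.
Measurability of `D` plays no role. -/
theorem measure_lt_iSup_mul_le {ι : Type*} [Nonempty ι] {D : Ω → EReal} {u : ι → EReal} {t : ℕ}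
    (ht : 1 ≤ t) {c : ENNReal} (h : ∀ i, μ {ω | D ω ≤ u i * (t : EReal)} ≤ c) :
    μ {ω | D ω < (⨆ i, u i) * (t : EReal)} ≤ c := by
  have ht0 : (0 : EReal) < t := by exact_mod_cast ht
  have htt : (t : EReal) ≠ ⊤ := EReal.natCast_ne_top t
  obtain ⟨v, hv, hlim, hmem⟩ := exists_seq_tendsto_sSup (Set.range_nonempty u) (OrderTop.bddAbove _)
  have hmono : Monotone fun n => {ω | D ω ≤ v n * (t : EReal)} := fun m n hmn ω hω =>
    le_trans hω (mul_le_mul_of_nonneg_right (hv hmn) ht0.le)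
  have hsub : {ω | D ω < (⨆ i, u i) * (t : EReal)} ⊆ ⋃ n, {ω | D ω ≤ v n * (t : EReal)} := by
    intro ω hω
    have h1 : D ω / t < sSup (Set.range u) := (EReal.div_lt_iff ht0 htt).2 hω
    obtain ⟨n, hn⟩ := (hlim.eventually_const_lt h1).exists
    exact Set.mem_iUnion.2 ⟨n, ((EReal.div_lt_iff ht0 htt).1 hn).le⟩
  refine (measure_mono hsub).trans ?_
  rw [hmono.measure_iUnion]
  refine iSup_le fun n => ?_
  obtain ⟨i, hi⟩ := hmem n
  exact hi ▸ h i

theorem measure_iInf_mul_lt_le {ι : Type*} [Nonempty ι] {D : Ω → EReal} {u : ι → EReal} {t : ℕ}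
    (ht : 1 ≤ t) {c : ENNReal} (h : ∀ i, μ {ω | u i * (t : EReal) ≤ D ω} ≤ c) :
    μ {ω | (⨅ i, u i) * (t : EReal) < D ω} ≤ c := by
  have ht0 : (0 : EReal) < t := by exact_mod_cast ht
  have htt : (t : EReal) ≠ ⊤ := EReal.natCast_ne_top t
  obtain ⟨v, hv, hlim, hmem⟩ := exists_seq_tendsto_sInf (Set.range_nonempty u) (OrderBot.bddBelow _)
  have hmono : Monotone fun n => {ω | v n * (t : EReal) ≤ D ω} := fun m n hmn ω hω =>
    le_trans (mul_le_mul_of_nonneg_right (hv hmn) ht0.le) hω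
  have hsub : {ω | (⨅ i, u i) * (t : EReal) < D ω} ⊆ ⋃ n, {ω | v n * (t : EReal) ≤ D ω} := by
    intro ω hω
    have h1 : sInf (Set.range u) < D ω / t := (EReal.lt_div_iff ht0 htt).2 hω
    obtain ⟨n, hn⟩ := (hlim.eventually_lt_const h1).exists
    exact Set.mem_iUnion.2 ⟨n, ((EReal.lt_div_iff ht0 htt).1 hn).le⟩
  refine (measure_mono hsub).trans ?_
  rw [hmono.measure_iUnion]
  refine iSup_le fun n => ?_
  obtain ⟨i, hi⟩ := hmem n
  exact hi ▸ h i

end Limits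

/-! ### The two capacity bounds. -/

section CapacityBounds

variable {Ω E : Type*} [MeasurableSpace Ω] [Fintype E] [DecidableEq E] {μ : Measure Ω}
  [IsProbabilityMeasure μ] {P : Matrix E E ℝ} {p : E → ℝ} {X : ℝ≥0 → Ω → E}

/-- The Chernoff bound for the data transmitted along a fixed path through the hops. -/
theorem IsMarkovChain.measure_path_le (hX : IsMarkovChain μ P p X)
    (hp : IsReversibleDistribution P p) (C : ℝ) {k : ℕ} (hk : 1 ≤ k) (F : Fin k → Set E)
    {θ : ℝ} (hθ : 0 < θ) (d : Fin k → ℕ) (x : ℝ) :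
    μ {ω | ∑ j, impulseResponse X C (F j) ω (pathStart d j) (pathStart d j + d j) ≤ x} ≤
      ENNReal.ofReal (Real.exp
        (θ * (x - (⨅ j, hopRate P C (F j) (-(k * θ))) * (∑ j, d j : ℕ)))) := by
  have hk0 : (0 : ℝ) < k := by exact_mod_cast hk
  set r := ⨅ j, hopRate P C (F j) (-(k * θ)) with hr
  have hmeas := fun j => hX.measurable_impulseResponse C (F j) (pathStart d j) (d j)
  have hmgf := lintegral_exp_sum_le (μ := μ) hk hmeas (y := -θ)
    (b := fun j => topEigenvalue (bMatrix P C (F j) (-(k * -θ))) * d j)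
    fun j => hX.lintegral_exp_impulseResponse_le hp C (F j) (k * -θ) _ _
  have h := measure_le_ofReal_exp_of_lintegral_exp_le (Finset.measurable_sum _ fun j _ => hmeas j)
    hmgf x
  have hset : {ω | ∑ j, impulseResponse X C (F j) ω (pathStart d j) (pathStart d j + d j) ≤ x} =
      {ω | -θ * x ≤ -θ *
        ∑ j, impulseResponse X C (F j) ω (pathStart d j) (pathStart d j + d j)} := by
    ext ω
    simp only [Set.mem_ofPred_eq]
    rw [mul_le_mul_left_of_neg (neg_neg_of_pos hθ)]
  rw [hset]
  refine h.trans (ENNReal.ofReal_le_ofReal (Real.exp_le_exp.2 ?_))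
  have hterm : ∀ j, topEigenvalue (bMatrix P C (F j) (-(k * -θ))) * d j ≤ -(k * θ) * r * d j := by
    intro j
    have hle : r ≤ hopRate P C (F j) (-(k * θ)) := ciInf_le (Set.finite_range _).bddBelow j
    have heq : topEigenvalue (bMatrix P C (F j) (-(k * -θ))) =
        -(k * θ) * hopRate P C (F j) (-(k * θ)) := by
      rw [hopRate, mul_neg, mul_div_cancel₀]
      exact neg_ne_zero.2 (mul_pos hk0 hθ).ne'
    rw [heq]
    exact mul_le_mul_of_nonneg_right
      (mul_le_mul_of_nonpos_left hle (neg_nonpos.2 (mul_pos hk0 hθ).le)) (d j).cast_nonneg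
  -- The `1 / k` from Hölder's inequality cancels the factor `k` in `kθ`, leaving `θ` in the
  -- exponent.
  have hsum : (∑ j, topEigenvalue (bMatrix P C (F j) (-(k * -θ))) * d j) / k ≤
      -θ * r * (∑ j, d j : ℕ) := by
    rw [div_le_iff₀ hk0]
    refine (Finset.sum_le_sum fun j _ => hterm j).trans_eq ?_
    rw [← Finset.mul_sum]
    push_cast
    ring
  linarith

theorem IsMarkovChain.measure_endToEnd_le_lowerRateAt (hX : IsMarkovChain μ P p X)
    (hp : IsReversibleDistribution P p) (C : ℝ) {k : ℕ} (hk : 1 ≤ k) (F : Fin k → Set E)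
    {ε : ℝ} (hε : 0 < ε) {t : ℕ} (ht : 1 ≤ t) {θ : ℝ} (hθ : 0 < θ) :
    μ {ω | endToEnd X C F t ω ≤ ((lowerRateAt P C F ε t θ * t : ℝ) : EReal)} ≤
      ENNReal.ofReal ε := by
  classical
  have ht0 : (0 : ℝ) < t := by exact_mod_cast ht
  set N := (t + k - 1).choose (k - 1) with hN
  have hN0 : 0 < N := Nat.choose_pos (by omega)
  have hN0' : (0 : ℝ) < N := by exact_mod_cast hN0
  set x := lowerRateAt P C F ε t θ * t with hx
  set I : Finset (Fin k →₀ ℕ) := Finset.finsuppAntidiag Finset.univ t with hI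
  -- Stars and bars: paths correspond to the ways of distributing `t` slots among `k` hops.
  have hcard : I.card = N := by
    rw [hI, Finset.card_finsuppAntidiag_nat_eq_choose, Finset.card_univ, Fintype.card_fin, hN,
      add_comm k t, ← Nat.choose_symm (by omega)]
    congr 1
    omega
  have hsub : {ω | endToEnd X C F t ω ≤ (x : EReal)} ⊆ ⋃ d ∈ I,
      {ω | ∑ j, impulseResponse X C (F j) ω (pathStart d j) (pathStart d j + d j) ≤ x} := by
    intro ω hω
    rcases departures_saturated_eq k (fun j => impulseResponse X C (F j) ω) t with
      htop | ⟨d, hd, hval⟩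
    · rw [Set.mem_ofPred_eq, endToEnd, htop] at hω
      exact absurd hω (EReal.coe_lt_top x).not_ge
    · rw [Set.mem_ofPred_eq, endToEnd, hval, EReal.coe_le_coe_iff] at hω
      refine Set.mem_iUnion₂.2 ⟨Finsupp.equivFunOnFinite.symm d, ?_, hω⟩
      simp [hI, Finset.mem_finsuppAntidiag, hd]
  have hterm : ∀ d ∈ I,
      μ {ω | ∑ j, impulseResponse X C (F j) ω (pathStart d j) (pathStart d j + d j) ≤ x} ≤
        ENNReal.ofReal (ε / N) := by
    intro d hd
    have hdt : ∑ j, d j = t := (Finset.mem_finsuppAntidiag.1 hd).1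
    -- The logarithmic terms in `lowerRateAt` are chosen so that the exponent is exactly `log (ε /
    -- N)`, which survives the union over `N` paths.
    refine (hX.measure_path_le hp C hk F hθ d x).trans (ENNReal.ofReal_le_ofReal (le_of_eq ?_))
    rw [hdt, ← Real.exp_log (div_pos hε hN0'), Real.log_div hε.ne' hN0'.ne', hx, lowerRateAt]
    congr 1
    field_simp
    ring
  calc μ {ω | endToEnd X C F t ω ≤ (x : EReal)}
      ≤ ∑ d ∈ I, μ {ω | ∑ j,
          impulseResponse X C (F j) ω (pathStart d j) (pathStart d j + d j) ≤ x} :=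
        (measure_mono hsub).trans (measure_biUnion_finset_le _ _)
    _ ≤ ∑ _d ∈ I, ENNReal.ofReal (ε / N) := Finset.sum_le_sum hterm
    _ = ENNReal.ofReal ε := by
        rw [Finset.sum_const, hcard, nsmul_eq_mul, ← ENNReal.ofReal_natCast,
          ← ENNReal.ofReal_mul hN0'.le, mul_div_cancel₀ _ hN0'.ne']

theorem IsMarkovChain.measure_upperRateAt_le_endToEnd (hX : IsMarkovChain μ P p X)
    (hp : IsReversibleDistribution P p) (C : ℝ) {k : ℕ} (hk : 1 ≤ k) (F : Fin k → Set E)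
    {ε : ℝ} (hε : 0 < ε) {t : ℕ} (ht : 1 ≤ t) {θ : ℝ} (hθ : 0 < θ) :
    μ {ω | ((upperRateAt P C F ε t θ * t : ℝ) : EReal) ≤ endToEnd X C F t ω} ≤
      ENNReal.ofReal ε := by
  rcases le_or_gt 1 ε with h1 | h1
  -- With this case gone `log ε < 0`. Chernoff's bound at parameter `kθ` yields the exponent `k log
  -- ε`, and only for negative `log ε` is that sure to be at most `log ε`.
  · exact prob_le_one.trans (by simpa using ENNReal.ofReal_le_ofReal h1)
  obtain ⟨k, rfl⟩ : ∃ l, k = l + 1 := ⟨k - 1, by omega⟩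
  have ht0 : (0 : ℝ) < t := by exact_mod_cast ht
  have hk1 : (1 : ℝ) ≤ (k + 1 : ℕ) := by exact_mod_cast hk
  set y : ℝ := (k + 1 : ℕ) * θ with hy
  have hy0 : 0 < y := mul_pos (by linarith) hθ
  set r := ⨆ j, hopRate P C (F j) y with hr
  set x := upperRateAt P C F ε t θ * t with hx
  have hle : hopRate P C (F (Fin.last k)) y ≤ r :=
    le_ciSup (f := fun j => hopRate P C (F j) y) (Set.finite_range _).bddAbove (Fin.last k)
  have hsub : {ω | (x : EReal) ≤ endToEnd X C F t ω} ⊆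
      {ω | y * x ≤ y * impulseResponse X C (F (Fin.last k)) ω 0 (0 + t)} := by
    intro ω hω
    have h := le_trans hω (departures_saturated_succ_le k
      (fun j => impulseResponse X C (F j) ω) (fun j => by simp [impulseResponse]) t)
    rw [EReal.coe_le_coe_iff] at h
    rw [Set.mem_ofPred_eq, zero_add]
    exact mul_le_mul_of_nonneg_left h hy0.le
  refine (measure_mono hsub).trans ((measure_le_ofReal_exp_of_lintegral_exp_le
    (hX.measurable_impulseResponse C _ 0 t)
    (hX.lintegral_exp_impulseResponse_le hp C _ y 0 t) x).trans (ENNReal.ofReal_le_ofReal ?_))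
  rw [← Real.exp_log hε, Real.exp_le_exp]
  have heq : topEigenvalue (bMatrix P C (F (Fin.last k)) (-y)) =
      y * hopRate P C (F (Fin.last k)) y := by
    rw [hopRate, mul_div_cancel₀ _ hy0.ne']
  have hyx : y * x = y * r * t - (k + 1 : ℕ) * Real.log ε := by
    rw [hx, upperRateAt, ← hy, ← hr, hy]
    field_simp
  rw [heq, hyx]
  have h2 : y * hopRate P C (F (Fin.last k)) y * t ≤ y * r * t := by gcongr
  nlinarith [Real.log_neg hε h1]

end CapacityBounds

theorem theorem2 {Ω E : Type*} [MeasurableSpace Ω] [Fintype E] [DecidableEq E]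
    (μ : Measure Ω) [IsProbabilityMeasure μ]
    (P : Matrix E E ℝ) (hP : IsGenerator P)
    (p : E → ℝ) (hp : IsReversibleDistribution P p)
    (X : ℝ≥0 → Ω → E) (hX : IsMarkovChain μ P p X)
    (C : ℝ) (hC : 0 < C)
    (k : ℕ) (hk : 1 ≤ k) (F : Fin k → Set E)
    (ε : ℝ) (hε : 0 < ε) (t : ℕ) (ht : 1 ≤ t) :
    ((∀ θ : ℝ, 0 < θ →
        μ.real {ω | endToEnd X C F t ω ≤ ((lowerRateAt P C F ε t θ * t : ℝ) : EReal)} ≤ ε) ∧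
      μ.real {ω | endToEnd X C F t ω < lowerRate P C F ε t * (t : EReal)} ≤ ε) ∧
    ((∀ θ : ℝ, 0 < θ →
        μ.real {ω | ((upperRateAt P C F ε t θ * t : ℝ) : EReal) ≤ endToEnd X C F t ω} ≤ ε) ∧
      μ.real {ω | upperRate P C F ε t * (t : EReal) < endToEnd X C F t ω} ≤ ε) := by
  have hreal : ∀ {s : Set Ω}, μ s ≤ ENNReal.ofReal ε → μ.real s ≤ ε := fun h =>
    ENNReal.toReal_le_of_le_ofReal hε.le h
  have : Nonempty (Set.Ioi (0 : ℝ)) := ⟨⟨1, Set.mem_Ioi.2 one_pos⟩⟩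
  have hlow := fun (θ : ℝ) (hθ : 0 < θ) =>
    hX.measure_endToEnd_le_lowerRateAt hp C hk F hε ht hθ
  have hupp := fun (θ : ℝ) (hθ : 0 < θ) =>
    hX.measure_upperRateAt_le_endToEnd hp C hk F hε ht hθ
  refine ⟨⟨fun θ hθ => hreal (hlow θ hθ), hreal (measure_lt_iSup_mul_le ht fun θ => ?_)⟩,
    ⟨fun θ hθ => hreal (hupp θ hθ), hreal (measure_iInf_mul_lt_le ht fun θ => ?_)⟩⟩
  · simpa [EReal.coe_mul] using hlow θ θ.2
  · simpa [EReal.coe_mul] using hupp θ θ.2
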